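/- Let $M$, $N$, $R$ be non-negative integers with $R \le \min(M,N)$, and let $\mathcal{M}_R=\{A\in\mathbb{R}^{M\times N} : \operatorname{rank}(A)=R\}$ be the set of real $M\times N$ matrices of rank exactly $R$. Then $\mathcal{M}_R$ is a $C^\infty$ smooth embedded submanifold of $\mathbb{R}^{M\times N}$ (that is, with the subspace topology it carries the structure of a $C^\infty$ manifold for which the inclusion into $\mathbb{R}^{M\times N}$ is a $C^\infty$ immersion and a topological embedding), and its dimension is $$\dim(\mathcal{M}_R)=MN-(M-R)(N-R)=(M+N-R)R .$$ -/

import Mathlib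

open scoped Manifold ContDiff Matrix.Norms.Frobenius

/-- The set `M_R` of real `M × N` matrices of rank exactly `R`. -/
def rankManifold (M N R : ℕ) : Set (Matrix (Fin M) (Fin N) ℝ) :=
  {A | A.rank = R}

/-- A subset `S` of a real normed space `E` is a `C^∞` embedded submanifold of dimension `d` if `S`,
with the subspace topology, carries an atlas of charts with values in `ℝ^d` that makes it a
`C^∞` manifold and for which the inclusion `S → E` is a `C^∞` embedding, that is, an immersion and
a homeomorphism onto its image. -/
def IsSmoothEmbeddedSubmanifold {E : Type*} [NormedAddCommGroup E] [NormedSpace ℝ E]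
    (S : Set E) (d : ℕ) : Prop :=
  ∃ _ : ChartedSpace (EuclideanSpace ℝ (Fin d)) S,
    IsManifold (𝓡 d) ∞ S ∧
      Manifold.IsSmoothEmbedding (𝓡 d) 𝓘(ℝ, E) ∞ (Subtype.val : S → E)

/-! A matrix X of rank R has an invertible R × R minor; permute rows and columns to make it the
upper left block A of (A B; C D). Wherever A stays invertible, an open condition, block elimination
shows that the rank is R exactly when the Schur complement D - C A⁻¹ B vanishes
(`Matrix.rank_fromBlocks_eq_card_iff`). Replacing D by this complement is a smooth shear, undone by
adding C A⁻¹ B back, so `schurChart` straightens the rank-R set to a linear slice. A set that is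
locally a slice is an embedded submanifold (`isSmoothEmbeddedSubmanifold_finrank`), and here A, B, C
are the free coordinates. -/

open Matrix in
/-- A matrix of rank `r` over a field has `r` linearly independent rows. -/
theorem Matrix.exists_linearIndependent_rows_of_rank_eq {K m n : Type*} [Field K] [Finite m]
    [Fintype n] {r : ℕ} {A : Matrix m n K} (hA : A.rank = r) :
    ∃ f : Fin r → m, LinearIndependent K (A.submatrix f id).row := by
  subst hA
  rw [rank_eq_finrank_span_row]
  obtain ⟨f, hf, -, hli⟩ := Submodule.exists_fun_fin_finrank_span_eq K (Set.range A.row)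
  choose g hg using hf
  refine ⟨g, ?_⟩
  rwa [show (A.submatrix g id).row = f from funext hg]

open Matrix in
/-- A matrix of rank `r` over a field has a nonsingular `r × r` submatrix. -/
theorem Matrix.exists_isUnit_submatrix_of_rank_eq {K m n : Type*} [Field K] [Fintype m] [Fintype n]
    {r : ℕ} {A : Matrix m n K} (hA : A.rank = r) :
    ∃ (f : Fin r → m) (g : Fin r → n), Function.Injective f ∧ Function.Injective g ∧
      IsUnit (A.submatrix f g) := by
  obtain ⟨f, hf⟩ := exists_linearIndependent_rows_of_rank_eq hA
  have hr : (A.submatrix f id)ᵀ.rank = r := by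
    rw [rank_transpose, hf.rank_matrix, Fintype.card_fin]
  obtain ⟨g, hg⟩ := exists_linearIndependent_rows_of_rank_eq hr
  have hu : IsUnit (A.submatrix f g) := by
    rw [← isUnit_transpose]
    exact linearIndependent_rows_iff_isUnit.1 hg
  refine ⟨f, g, fun i j hij ↦ ?_, fun i j hij ↦ ?_, hu⟩
  · exact (linearIndependent_rows_iff_isUnit.2 hu).injective
      (funext fun k ↦ by simp [Matrix.row, hij])
  · exact (linearIndependent_cols_iff_isUnit.2 hu).injective
      (funext fun k ↦ by simp [Matrix.col, hij])

/-- An injection `Fin r → Fin n` extends to a bijection `Fin r ⊕ Fin (n - r) ≃ Fin n`. -/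
theorem Function.Injective.exists_sum_equiv_fin {r n : ℕ} {f : Fin r → Fin n}
    (hf : Function.Injective f) :
    ∃ e : Fin r ⊕ Fin (n - r) ≃ Fin n, ∀ i, e (Sum.inl i) = f i := by
  classical
  have hc : Fintype.card ↥(Set.range f)ᶜ = n - r := by
    rw [Fintype.card_compl_set, Set.card_range_of_injective hf, Fintype.card_fin, Fintype.card_fin]
  exact ⟨((Equiv.ofInjective f hf).sumCongr (Fintype.equivFinOfCardEq hc).symm).trans
    (Equiv.Set.sumCompl _), fun i ↦ by simp⟩

open Matrix in
/-- If the upper left block of a block matrix is invertible, then the rank is the size of that block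
if and only if the Schur complement vanishes. -/
theorem Matrix.rank_fromBlocks_eq_card_iff {K r m n : Type*} [Field K] [Fintype r] [Fintype m]
    [Fintype n] [DecidableEq r] [DecidableEq m] [DecidableEq n] {A : Matrix r r K} (hA : IsUnit A)
    (B : Matrix r n K) (C : Matrix m r K) (D : Matrix m n K) :
    (fromBlocks A B C D).rank = Fintype.card r ↔ D - C * Ring.inverse A * B = 0 := by
  obtain ⟨⟨A, A', h, h'⟩, rfl⟩ := hA
  let : Invertible A := ⟨A', h', h⟩
  have hunit : IsUnit A := isUnit_of_invertible A
  simp only [Ring.inverse_invertible]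
  set S := D - C * ⅟A * B with hS
  -- Block LDU factorisation: the outer factors are unitriangular, hence have determinant 1 and
  -- preserve rank.
  have hrank : (fromBlocks A B C D).rank = (fromBlocks A 0 0 S).rank := by
    rw [fromBlocks_eq_of_invertible₁₁, rank_mul_eq_left_of_isUnit_det,
      rank_mul_eq_right_of_isUnit_det]
    · simp
    · simp
  rw [hrank]
  constructor
  · intro hr
    ext i j
    -- A nonzero entry of `S` would border `A` to an invertible minor of size r + 1, exceeding the
    -- rank.
    by_contra hij
    have hsub : (fromBlocks A 0 0 S).submatrix (Sum.map id fun _ : Unit ↦ i)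
        (Sum.map id fun _ : Unit ↦ j) = fromBlocks A 0 0 (of fun _ _ ↦ S i j) := by
      ext (_ | _) (_ | _) <;> rfl
    have hle := rank_submatrix_le (fromBlocks A 0 0 S) (Sum.map id fun _ : Unit ↦ i)
      (Sum.map id fun _ : Unit ↦ j)
    rw [hsub, hr, rank_of_isUnit, Fintype.card_sum, Fintype.card_unit] at hle
    · omega
    · rw [isUnit_fromBlocks_zero₁₂]
      refine ⟨hunit, ?_⟩
      rw [isUnit_iff_isUnit_det]
      simpa using hij
  · intro h0
    rw [h0]
    apply le_antisymm
    · have : fromBlocks A (0 : Matrix r n K) (0 : Matrix m r K) 0 =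
          fromRows A 0 * fromCols (1 : Matrix r r K) (0 : Matrix r n K) := by
        rw [fromRows_mul_fromCols]; simp
      rw [this]
      exact (rank_mul_le_left _ _).trans (rank_le_card_width _)
    · rw [← rank_of_isUnit A hunit]
      exact rank_submatrix_le (fromBlocks A (0 : Matrix r n K) (0 : Matrix m r K) 0) Sum.inl Sum.inl

/-! ### Smoothness of the Schur complement -/

theorem contDiff_matrix_mul {l m n : Type*} [Fintype l] [Fintype m] [Fintype n] {k : ℕ∞ω} :
    ContDiff ℝ k fun p : Matrix l m ℝ × Matrix m n ℝ ↦ p.1 * p.2 :=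
  IsBoundedBilinearMap.contDiff (𝕜 := ℝ)
    { add_left := fun _ _ _ ↦ Matrix.add_mul _ _ _
      smul_left := fun _ _ _ ↦ Matrix.smul_mul _ _ _
      add_right := fun _ _ _ ↦ Matrix.mul_add _ _ _
      smul_right := fun _ _ _ ↦ Matrix.mul_smul _ _ _
      bound := ⟨1, one_pos, fun A B ↦ by simpa using Matrix.frobenius_norm_mul A B⟩ }

/-- Splitting a matrix into the four blocks given by decompositions of its index types. -/
def matrixBlocksEquiv {r m n m' n' : Type*} (e : r ⊕ m ≃ m') (e' : r ⊕ n ≃ n') :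
    Matrix m' n' ℝ ≃ₗ[ℝ]
      (Matrix r r ℝ × Matrix r n ℝ × Matrix m r ℝ) × Matrix m n ℝ where
  toFun X :=
    let Y := X.submatrix e e'
    ((Y.toBlocks₁₁, Y.toBlocks₁₂, Y.toBlocks₂₁), Y.toBlocks₂₂)
  invFun p := (Matrix.fromBlocks p.1.1 p.1.2.1 p.1.2.2 p.2).submatrix e.symm e'.symm
  map_add' _ _ := rfl
  map_smul' _ _ := rfl
  left_inv X := by simp [Matrix.fromBlocks_toBlocks]
  right_inv p := by simp

theorem isOpen_isUnit_fst_fst {r Y Z : Type*} [Fintype r] [DecidableEq r] [TopologicalSpace Y]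
    [TopologicalSpace Z] : IsOpen {p : (Matrix r r ℝ × Y) × Z | IsUnit p.1.1} :=
  -- Units form an open set in a complete normed ring.
  have : CompleteSpace (Matrix r r ℝ) := FiniteDimensional.complete ℝ _
  Units.isOpen.preimage (continuous_fst.comp continuous_fst)

section SchurChart

variable {r m n : Type*} [Fintype r] [Fintype m] [Fintype n] [DecidableEq r]

theorem contDiffOn_schur_correction :
    ContDiffOn ℝ ∞ (fun p : (Matrix r r ℝ × Matrix r n ℝ × Matrix m r ℝ) × Matrix m n ℝ ↦
      p.1.2.2 * Ring.inverse p.1.1 * p.1.2.1) {p | IsUnit p.1.1} := by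
  have : CompleteSpace (Matrix r r ℝ) := FiniteDimensional.complete ℝ _
  rintro p ⟨u, hu⟩
  have hinv : ContDiffAt ℝ ∞ (Ring.inverse : Matrix r r ℝ → Matrix r r ℝ) p.1.1 :=
    hu ▸ contDiffAt_ringInverse ℝ u
  have hi : ContDiffAt ℝ ∞ (fun p : (Matrix r r ℝ × Matrix r n ℝ × Matrix m r ℝ) × Matrix m n ℝ ↦
      Ring.inverse p.1.1) p := hinv.comp p (contDiff_fst.comp contDiff_fst).contDiffAt
  have hC : ContDiffAt ℝ ∞ (fun p : (Matrix r r ℝ × Matrix r n ℝ × Matrix m r ℝ) × Matrix m n ℝ ↦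
      p.1.2.2) p := by fun_prop
  have hB : ContDiffAt ℝ ∞ (fun p : (Matrix r r ℝ × Matrix r n ℝ × Matrix m r ℝ) × Matrix m n ℝ ↦
      p.1.2.1) p := by fun_prop
  exact (contDiff_matrix_mul.contDiffAt.comp p
    ((contDiff_matrix_mul.contDiffAt.comp p (hC.prodMk hi)).prodMk hB)).contDiffWithinAt

theorem contDiffOn_sub_schur_correction :
    ContDiffOn ℝ ∞ (fun p : (Matrix r r ℝ × Matrix r n ℝ × Matrix m r ℝ) × Matrix m n ℝ ↦
      (p.1, p.2 - p.1.2.2 * Ring.inverse p.1.1 * p.1.2.1)) {p | IsUnit p.1.1} :=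
  contDiffOn_fst.prodMk (contDiffOn_snd.sub contDiffOn_schur_correction)

theorem contDiffOn_add_schur_correction :
    ContDiffOn ℝ ∞ (fun p : (Matrix r r ℝ × Matrix r n ℝ × Matrix m r ℝ) × Matrix m n ℝ ↦
      (p.1, p.2 + p.1.2.2 * Ring.inverse p.1.1 * p.1.2.1)) {p | IsUnit p.1.1} :=
  contDiffOn_fst.prodMk (contDiffOn_snd.add contDiffOn_schur_correction)

variable (r m n) in
/-- The diffeomorphism replacing the lower right block by the Schur complement of the upper left
block, where the latter is invertible. -/
noncomputable def schurChart :
    OpenPartialHomeomorph ((Matrix r r ℝ × Matrix r n ℝ × Matrix m r ℝ) × Matrix m n ℝ)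
      ((Matrix r r ℝ × Matrix r n ℝ × Matrix m r ℝ) × Matrix m n ℝ) where
  toFun p := (p.1, p.2 - p.1.2.2 * Ring.inverse p.1.1 * p.1.2.1)
  invFun p := (p.1, p.2 + p.1.2.2 * Ring.inverse p.1.1 * p.1.2.1)
  source := {p | IsUnit p.1.1}
  target := {p | IsUnit p.1.1}
  map_source' _ h := h
  map_target' _ h := h
  left_inv' _ _ := by simp
  right_inv' _ _ := by simp
  open_source := isOpen_isUnit_fst_fst
  open_target := isOpen_isUnit_fst_fst
  continuousOn_toFun := contDiffOn_sub_schur_correction.continuousOn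
  continuousOn_invFun := contDiffOn_add_schur_correction.continuousOn

end SchurChart

/-- Reindexing rows and columns by bijections preserves rank, so the Schur criterion transfers to
any position of the invertible minor. -/
theorem exists_rankManifold_slice_chart {M N R : ℕ} {X : Matrix (Fin M) (Fin N) ℝ}
    (hX : X ∈ rankManifold M N R) :
    ∃ φ : OpenPartialHomeomorph (Matrix (Fin M) (Fin N) ℝ)
        ((Matrix (Fin R) (Fin R) ℝ × Matrix (Fin R) (Fin (N - R)) ℝ ×
          Matrix (Fin (M - R)) (Fin R) ℝ) × Matrix (Fin (M - R)) (Fin (N - R)) ℝ),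
      X ∈ φ.source ∧ ContDiffOn ℝ ∞ φ φ.source ∧ ContDiffOn ℝ ∞ φ.symm φ.target ∧
        ∀ Y ∈ φ.source, Y ∈ rankManifold M N R ↔ (φ Y).2 = 0 := by
  obtain ⟨f, g, hf, hg, hu⟩ := Matrix.exists_isUnit_submatrix_of_rank_eq hX
  obtain ⟨e, he⟩ := hf.exists_sum_equiv_fin
  obtain ⟨e', he'⟩ := hg.exists_sum_equiv_fin
  set T := (matrixBlocksEquiv e e').toContinuousLinearEquiv with hT
  have hTapply : ∀ Y, T Y = matrixBlocksEquiv e e' Y := fun _ ↦ rfl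
  refine ⟨T.toHomeomorph.transOpenPartialHomeomorph (schurChart _ _ _), ?_, ?_, ?_, ?_⟩
  · change IsUnit (X.submatrix e e').toBlocks₁₁
    convert hu using 1
    ext i j
    simp [Matrix.toBlocks₁₁, he, he']
  · exact contDiffOn_sub_schur_correction.comp T.contDiff.contDiffOn fun _ h ↦ h
  · exact T.symm.contDiff.comp_contDiffOn contDiffOn_add_schur_correction
  · intro Y hY
    change IsUnit (Y.submatrix e e').toBlocks₁₁ at hY
    have := Matrix.rank_fromBlocks_eq_card_iff hY (Y.submatrix e e').toBlocks₁₂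
      (Y.submatrix e e').toBlocks₂₁ (Y.submatrix e e').toBlocks₂₂
    rw [Matrix.fromBlocks_toBlocks, Matrix.rank_submatrix, Fintype.card_fin] at this
    exact this

/-! ### Submanifolds from slice charts -/

section SliceChart

variable {E V F : Type*} [TopologicalSpace E] [TopologicalSpace V] [TopologicalSpace F] [Zero F]
  {S : Set E}

/-- The chart of a subset `S` induced by a chart of the ambient space in which `S` is given by the
vanishing of the second coordinate. -/
noncomputable def sliceChart (φ : OpenPartialHomeomorph E (V × F))
    (h : ∀ y ∈ φ.source, y ∈ S ↔ (φ y).2 = 0) (x : S) : OpenPartialHomeomorph S V :=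
  have hmem : ∀ v : V, (v, (0 : F)) ∈ φ.target → φ.symm (v, 0) ∈ S := fun v hv ↦
    (h _ (φ.map_target hv)).2 (by rw [φ.right_inv hv])
  have hpair : ∀ y : S, (y : E) ∈ φ.source → ((φ y).1, (0 : F)) = φ y := fun y hy ↦
    Prod.ext rfl ((h y hy).1 y.2).symm
  open Classical in
  { toFun := fun y ↦ (φ y).1
    -- The base point `x` only serves as a default value off the target.
    invFun := fun v ↦ if hv : (v, (0 : F)) ∈ φ.target then ⟨φ.symm (v, 0), hmem v hv⟩ else x
    source := Subtype.val ⁻¹' φ.source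
    target := {v | (v, (0 : F)) ∈ φ.target}
    map_source' := fun y hy ↦ by
      simp only [Set.mem_ofPred_eq]
      rw [hpair y hy]
      exact φ.map_source hy
    map_target' := fun v hv ↦ by
      simp only [Set.mem_ofPred_eq] at hv
      simp [hv]
    left_inv' := fun y hy ↦ by
      have hy' : (y : E) ∈ φ.source := hy
      have ht : ((φ y).1, (0 : F)) ∈ φ.target := by
        rw [hpair y hy]
        exact φ.map_source hy
      rw [dif_pos ht]
      ext
      simp only [hpair y hy, φ.left_inv hy']
    right_inv' := fun v hv ↦ by
      simp only [Set.mem_ofPred_eq] at hv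
      simp [hv]
    open_source := φ.open_source.preimage continuous_subtype_val
    open_target := φ.open_target.preimage (by fun_prop)
    continuousOn_toFun := continuous_fst.comp_continuousOn
      (φ.continuousOn.comp continuous_subtype_val.continuousOn fun _ hy ↦ hy)
    continuousOn_invFun := by
      rw [continuousOn_iff_continuous_domRestrict, continuous_induced_rng]
      have hc : ContinuousOn (fun v : V ↦ φ.symm (v, (0 : F))) {v | (v, (0 : F)) ∈ φ.target} :=
        φ.symm.continuousOn.comp (by fun_prop) fun _ hv ↦ hv
      rw [continuousOn_iff_continuous_domRestrict] at hc
      refine hc.congr fun v ↦ ?_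
      have hv : ((v : V), (0 : F)) ∈ φ.target := v.2
      simp [hv] }

variable {φ : OpenPartialHomeomorph E (V × F)} {h : ∀ y ∈ φ.source, y ∈ S ↔ (φ y).2 = 0} {x : S}

theorem sliceChart_apply (y : S) : sliceChart φ h x y = (φ y).1 := rfl

theorem mem_sliceChart_source {y : S} : y ∈ (sliceChart φ h x).source ↔ (y : E) ∈ φ.source :=
  Iff.rfl

theorem mem_sliceChart_target {v : V} :
    v ∈ (sliceChart φ h x).target ↔ (v, (0 : F)) ∈ φ.target :=
  Iff.rfl

theorem coe_sliceChart_symm_apply {v : V} (hv : (v, (0 : F)) ∈ φ.target) :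
    ((sliceChart φ h x).symm v : E) = φ.symm (v, 0) := by
  classical
  exact congrArg Subtype.val (dif_pos hv)

end SliceChart

section Slice

variable {E V F : Type*} [NormedAddCommGroup E] [NormedSpace ℝ E] [NormedAddCommGroup V]
  [NormedSpace ℝ V] [NormedAddCommGroup F] [NormedSpace ℝ F] {S : Set E}

/-- On its source the transition map is `v ↦ (φ' (φ.symm (v, 0))).1`, a composite of smooth ambient
maps. -/
theorem contDiffOn_sliceChart_transition {φ : OpenPartialHomeomorph E (V × F)}
    {h : ∀ y ∈ φ.source, y ∈ S ↔ (φ y).2 = 0} {x : S} {φ' : OpenPartialHomeomorph E (V × F)}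
    {h' : ∀ y ∈ φ'.source, y ∈ S ↔ (φ' y).2 = 0} {x' : S}
    (hφ : ContDiffOn ℝ ∞ φ.symm φ.target) (hφ' : ContDiffOn ℝ ∞ φ' φ'.source) :
    ContDiffOn ℝ ∞ ((sliceChart φ h x).symm.trans (sliceChart φ' h' x'))
      ((sliceChart φ h x).symm.trans (sliceChart φ' h' x')).source := by
  have hsub : ∀ v ∈ ((sliceChart φ h x).symm.trans (sliceChart φ' h' x')).source,
      (v, (0 : F)) ∈ φ.target ∧ φ.symm (v, 0) ∈ φ'.source := by
    intro v hv
    rw [OpenPartialHomeomorph.trans_source, OpenPartialHomeomorph.symm_source] at hv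
    have hv1 := mem_sliceChart_target.1 hv.1
    have hv2 : (((sliceChart φ h x).symm v : S) : E) ∈ φ'.source := hv.2
    rw [coe_sliceChart_symm_apply hv1] at hv2
    exact ⟨hv1, hv2⟩
  have hin : ContDiffOn ℝ ∞ (fun v : V ↦ φ.symm (v, (0 : F)))
      ((sliceChart φ h x).symm.trans (sliceChart φ' h' x')).source :=
    hφ.comp (by fun_prop) fun v hv ↦ (hsub v hv).1
  refine (contDiff_fst.comp_contDiffOn (hφ'.comp hin fun v hv ↦ (hsub v hv).2)).congr
    fun v hv ↦ ?_
  simp only [OpenPartialHomeomorph.coe_trans, Function.comp_apply, sliceChart_apply,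
    coe_sliceChart_symm_apply (hsub v hv).1]

/-- A subset of a normed space that is locally a slice is an embedded submanifold. -/
theorem isSmoothEmbeddedSubmanifold_of_slice_charts {d : ℕ}
    (L : (EuclideanSpace ℝ (Fin d) × F) ≃L[ℝ] E)
    (hS : ∀ x ∈ S, ∃ φ : OpenPartialHomeomorph E (EuclideanSpace ℝ (Fin d) × F),
      x ∈ φ.source ∧ ContDiffOn ℝ ∞ φ φ.source ∧ ContDiffOn ℝ ∞ φ.symm φ.target ∧
        ∀ y ∈ φ.source, y ∈ S ↔ (φ y).2 = 0) :
    IsSmoothEmbeddedSubmanifold S d := by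
  choose φ hx hφ hφ' hφS using fun x : S ↦ hS x x.2
  let c : ChartedSpace (EuclideanSpace ℝ (Fin d)) S :=
    { atlas := Set.range fun x : S ↦ sliceChart (φ x) (hφS x) x
      chartAt := fun x ↦ sliceChart (φ x) (hφS x) x
      mem_chart_source := fun x ↦ hx x
      chart_mem_atlas := fun x ↦ ⟨x, rfl⟩ }
  have hmfd : IsManifold (𝓡 d) ∞ S := by
    refine isManifold_of_contDiffOn _ _ _ ?_
    rintro _ _ ⟨x, rfl⟩ ⟨y, rfl⟩
    simpa using contDiffOn_sliceChart_transition (x := x) (x' := y) (h := hφS x)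
      (h' := hφS y) (hφ' x) (hφ y)
  refine ⟨c, hmfd, ?_, .subtypeVal⟩
  -- In the slice chart on `S` and the ambient chart `φ x` followed by `L`, the inclusion reads `v ↦
  -- L (v, 0)`.
  refine Manifold.IsImmersionOfComplement.isImmersion (F := F) fun x ↦ ?_
  refine .mk_of_charts L (chartAt _ x)
    ((φ x).trans L.toHomeomorph.toOpenPartialHomeomorph) (mem_chart_source _ x) ?_
    (IsManifold.chart_mem_maximalAtlas x) ?_ ?_ ?_
  · simpa using hx x
  · apply StructureGroupoid.mem_maximalAtlas_of_mem_groupoid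
    rw [contDiffGroupoid, mem_groupoid_of_pregroupoid]
    constructor
    · simpa [contDiffPregroupoid] using! L.contDiff.comp_contDiffOn (hφ x)
    · simpa [contDiffPregroupoid] using! (hφ' x).comp L.symm.contDiff.contDiffOn
        (s := L.symm ⁻¹' (φ x).target) fun _ hy ↦ hy
  · intro y hy
    simpa using mem_sliceChart_source.1 hy
  · intro v hv
    have hv' : (v, (0 : F)) ∈ (φ x).target := by
      simpa using! hv
    have := coe_sliceChart_symm_apply (h := hφS x) (x := x) hv'
    have key : L (φ x ((sliceChart (φ x) (hφS x) x).symm v)) = L (v, 0) := by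
      rw [this, (φ x).right_inv hv']
    exact key

/-- A variant of `isSmoothEmbeddedSubmanifold_of_slice_charts` with slice charts modelled on an
arbitrary finite-dimensional space. -/
theorem isSmoothEmbeddedSubmanifold_finrank [FiniteDimensional ℝ V] (L : (V × F) ≃L[ℝ] E)
    (hS : ∀ x ∈ S, ∃ φ : OpenPartialHomeomorph E (V × F),
      x ∈ φ.source ∧ ContDiffOn ℝ ∞ φ φ.source ∧ ContDiffOn ℝ ∞ φ.symm φ.target ∧
        ∀ y ∈ φ.source, y ∈ S ↔ (φ y).2 = 0) :
    IsSmoothEmbeddedSubmanifold S (Module.finrank ℝ V) := by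
  let K : (EuclideanSpace ℝ (Fin (Module.finrank ℝ V)) × F) ≃L[ℝ] V × F :=
    toEuclidean.symm.prodCongr (.refl ℝ F)
  refine isSmoothEmbeddedSubmanifold_of_slice_charts (K.trans L) fun x hx ↦ ?_
  obtain ⟨φ, hxφ, hφ, hφ', h⟩ := hS x hx
  refine ⟨φ.transHomeomorph K.symm.toHomeomorph, hxφ, K.symm.contDiff.comp_contDiffOn hφ,
    hφ'.comp K.contDiff.contDiffOn fun _ hy ↦ hy, h⟩

end Slice

theorem proposition1 (M N R : ℕ) (hM : R ≤ M) (hN : R ≤ N) :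
    ∃ d : ℕ, IsSmoothEmbeddedSubmanifold (rankManifold M N R) d ∧
      (d : ℤ) = M * N - (M - R) * (N - R) ∧
      (d : ℤ) = (M + N - R) * R := by
  -- Writing M = R + m and N = R + n removes the truncated subtractions from the block sizes, so the
  -- dimension is R² + Rn + mR.
  obtain ⟨m, rfl⟩ := Nat.exists_eq_add_of_le hM
  obtain ⟨n, rfl⟩ := Nat.exists_eq_add_of_le hN
  -- Any linear identification of the model spaces will do; it need not be compatible with the slice
  -- charts.
  let L := (matrixBlocksEquiv (finSumFinEquiv.trans (finCongr (Nat.add_sub_cancel' hM)))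
    (finSumFinEquiv.trans (finCongr (Nat.add_sub_cancel' hN)))).toContinuousLinearEquiv.symm
  refine ⟨_, isSmoothEmbeddedSubmanifold_finrank L fun X hX ↦ exists_rankManifold_slice_chart hX,
    ?_, ?_⟩ <;>
  · simp only [Module.finrank_prod, Module.finrank_matrix, Fintype.card_fin, Module.finrank_self,
      Nat.add_sub_cancel_left]
    push_cast
    ring
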